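/- All Banach spaces are real. For a Banach space $Z$ write $B_Z$, $S_Z$ for its closed unit ball and unit sphere, and $B(z,r)=\{y\in Z:\|y-z\|\le r\}$. For a Banach space $X\neq\{0\}$ with dual $X^*$, define $$\mathcal T(X):=\inf\Big\{r>0:\ \exists\, n\in\mathbb N,\ x_1,\dots,x_n\in S_X,\ \exists\, \emptyset\neq W\subseteq B_X \text{ relatively weakly open in } B_X,\ W\subseteq\bigcup_{i=1}^n B(x_i,r)\Big\},$$ $$\mathcal T_{w^*}(X^*):=\inf\Big\{r>0:\ \exists\, n\in\mathbb N,\ f_1,\dots,f_n\in S_{X^*},\ \exists\, \emptyset\neq W\subseteq B_{X^*} \text{ relatively weak-star open in } B_{X^*},\ W\subseteq\bigcup_{i=1}^n B(f_i,r)\Big\},$$ where the weak-star topology on $X^*$ is $\sigma(X^*,X)$. A bounded linear operator $T:X\to X$ is weakly compact if $T(B_X)$ is relatively weakly compact in $X$. Let $I$ denote the identity operator on $X$. **Proposition.** Let $X$ be a Banach space. Then for every weakly compact operator $T:X\to X$ with $\|T\|=1$, $$\|T+I\|\ \ge\ \mathcal T(X)\qquad\text{and}\qquad \|T+I\|\ \ge\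 \mathcal T_{w^*}(X^*).$$ -/

import Mathlib

/-- The Daugavet index of thickness `𝒯(X)` of a real normed space `X`: the infimum of all `r > 0`
such that some non-empty relatively weakly open subset `W = U ∩ B_X` of the closed unit ball
(`U` open in the weak topology) is covered by finitely many closed balls of radius `r` centred at
points of the unit sphere. If `X` is non-zero, then `r = 2` is admissible, so that the infimum is
that of a non-empty set of reals bounded below by `0`. -/
noncomputable def daugavetThickness (X : Type*) [NormedAddCommGroup X] [NormedSpace ℝ X] : ℝ :=
  sInf {r : ℝ | 0 < r ∧
    ∃ (n : ℕ) (x : Fin n → X), (∀ i, ‖x i‖ = 1) ∧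
      ∃ U : Set (WeakSpace ℝ X), IsOpen U ∧
        (toWeakSpace ℝ X ⁻¹' U ∩ Metric.closedBall (0 : X) 1).Nonempty ∧
        toWeakSpace ℝ X ⁻¹' U ∩ Metric.closedBall (0 : X) 1 ⊆ ⋃ i, Metric.closedBall (x i) r}

/-- The weak-star Daugavet index of thickness `𝒯_{w*}(X*)` of the dual `X*` of a real normed
space `X`: as `daugavetThickness`, computed in `X*` (with the dual norm), but with relatively
weak-star open subsets of the closed unit ball of `X*`. -/
noncomputable def weakStarDaugavetThicknessDual
    (X : Type*) [NormedAddCommGroup X] [NormedSpace ℝ X] : ℝ :=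
  sInf {r : ℝ | 0 < r ∧
    ∃ (n : ℕ) (f : Fin n → StrongDual ℝ X), (∀ i, ‖f i‖ = 1) ∧
      ∃ U : Set (WeakDual ℝ X), IsOpen U ∧
        (StrongDual.toWeakDual ⁻¹' U ∩ Metric.closedBall (0 : StrongDual ℝ X) 1).Nonempty ∧
        StrongDual.toWeakDual ⁻¹' U ∩ Metric.closedBall (0 : StrongDual ℝ X) 1 ⊆
          ⋃ i, Metric.closedBall (f i) r}

/-- A bounded linear operator `T : X → Y` is weakly compact if the image of the closed unit ball of
`X` is relatively weakly compact, i.e. has compact closure in the weak topology of `Y`. -/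
def IsWeaklyCompactOperator {X Y : Type*} [NormedAddCommGroup X] [NormedSpace ℝ X]
    [NormedAddCommGroup Y] [NormedSpace ℝ Y] (T : X →L[ℝ] Y) : Prop :=
  IsCompact (closure (toWeakSpace ℝ Y '' (T '' Metric.closedBall (0 : X) 1)))

open Topology Metric Set

/-! By Namioka's theorem a weakly compact `K` containing `T(B_X)` has a relatively weakly open piece
of diameter at most `ε` inside `{‖y‖ > 1 - ε}`. Pull it back by `T` to a relatively weakly open `W ⊆
B_X`, and pick `x₀ ∈ W`. For `x ∈ W`, `T x` is nearly the unit vector `u = T x₀ / ‖T x₀‖`, so `‖x +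
u‖ ≤ ‖x + T x‖ + 2ε ≤ ‖T + I‖ + 2ε`: one ball, centred at `-u`, covers `W`. In the dual the same
argument runs with `T*`. Weak compactness of `T` puts the range of `T**` in `X`, so `T*` is
weak-star-to-weak continuous and `T*(B_{X*})` is weakly compact. -/

/-- Continuous linear functionals are continuous for the weak topology. -/
theorem continuous_apply_toWeakSpace_symm {X : Type*} [NormedAddCommGroup X] [NormedSpace ℝ X]
    (f : StrongDual ℝ X) : Continuous fun x : WeakSpace ℝ X => f ((toWeakSpace ℝ X).symm x) :=
  WeakBilin.eval_continuous (topDualPairing ℝ X).flip f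

/-- Closed balls are weakly closed. -/
theorem isClosed_toWeakSpace_image_closedBall {X : Type*} [NormedAddCommGroup X] [NormedSpace ℝ X]
    (z : X) (r : ℝ) : IsClosed (toWeakSpace ℝ X '' closedBall z r) := by
  have h := (convex_closedBall z r).toWeakSpace_closure ℝ
  rw [isClosed_closedBall.closure_eq] at h
  rw [h]
  exact isClosed_closure

/-- The complement of a closed ball around the origin is weakly open. -/
theorem isOpen_weak_setOf_lt_norm {X : Type*} [NormedAddCommGroup X] [NormedSpace ℝ X] (r : ℝ) :
    IsOpen {x : WeakSpace ℝ X | r < ‖(toWeakSpace ℝ X).symm x‖} := by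
  convert (isClosed_toWeakSpace_image_closedBall (0 : X) r).isOpen_compl using 1
  ext x
  obtain ⟨x, rfl⟩ := (toWeakSpace ℝ X).surjective x
  simp

/-- A basis of neighbourhoods in a weak topology, in terms of finite families of functionals. -/
theorem LinearMap.exists_finset_of_mem_nhds_weakBilin {E F : Type*} [AddCommGroup E] [Module ℝ E]
    [AddCommGroup F] [Module ℝ F] (B : E →ₗ[ℝ] F →ₗ[ℝ] ℝ) {x : WeakBilin B}
    {U : Set (WeakBilin B)} (hU : U ∈ 𝓝 x) :
    ∃ (s : Finset F) (r : ℝ), 0 < r ∧ ∀ y : WeakBilin B,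
      (∀ f ∈ s, |B y f - B x f| < r) → y ∈ U := by
  obtain ⟨s, r, hr, h⟩ := (B.weakBilin_withSeminorms.mem_nhds_iff x U).1 hU
  refine ⟨s, r, hr, fun y hy => h ((Seminorm.mem_ball _).2
    (Seminorm.finset_sup_apply_lt hr fun f hf => ?_))⟩
  have key : ∀ a b : E, |B a f - B b f| < r → LinearMap.toSeminormFamily B f (a - b) < r := by
    intro a b hab
    rwa [← LinearMap.sub_apply, ← map_sub] at hab
  exact key y x (hy f hf)

/-- A basis of neighbourhoods in the weak topology of a normed space. -/
theorem exists_functionals_of_mem_nhds_weak {X : Type*} [NormedAddCommGroup X] [NormedSpace ℝ X]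
    {x : WeakSpace ℝ X} {U : Set (WeakSpace ℝ X)} (hU : U ∈ 𝓝 x) :
    ∃ (s : Finset (StrongDual ℝ X)) (r : ℝ), 0 < r ∧ ∀ y : WeakSpace ℝ X,
      (∀ f ∈ s, |f ((toWeakSpace ℝ X).symm y) - f ((toWeakSpace ℝ X).symm x)| < r) → y ∈ U :=
  (topDualPairing ℝ X).flip.exists_finset_of_mem_nhds_weakBilin hU

/-! ### Countable tightness and norm fragmentability -/

/-- **Kaplansky's theorem**: the weak topology of a normed space has countable tightness. -/
theorem exists_countable_subset_mem_closure_weak {X : Type*} [NormedAddCommGroup X]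
    [NormedSpace ℝ X] {A : Set (WeakSpace ℝ X)} {x : WeakSpace ℝ X} (hx : x ∈ closure A) :
    ∃ C ⊆ A, C.Countable ∧ x ∈ closure C := by
  have key : ∀ n m : ℕ, ∃ F : Set (WeakSpace ℝ X), F ⊆ A ∧ F.Finite ∧
      ∀ f : Fin n → StrongDual ℝ X, (∀ i, ‖f i‖ ≤ m) →
        ∃ a ∈ F, ∀ i, |f i ((toWeakSpace ℝ X).symm a) - f i ((toWeakSpace ℝ X).symm x)| < 1 := by
    intro n m
    -- Tuples of `n` functionals of norm at most `m` form a weak-star compact set, so finitely many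
    -- points of `A` serve them all.
    let Q : Set (Fin n → WeakDual ℝ X) :=
      univ.pi fun _ => WeakDual.toStrongDual ⁻¹' closedBall 0 m
    have hQ : IsCompact Q := isCompact_univ_pi fun _ => WeakDual.isCompact_closedBall 0 _
    let O : A → Set (Fin n → WeakDual ℝ X) := fun a =>
      {f | ∀ i, |f i ((toWeakSpace ℝ X).symm a) - f i ((toWeakSpace ℝ X).symm x)| < 1}
    have hO : ∀ a, IsOpen (O a) := by
      intro a
      simp only [O, ofPred_forall]
      refine isOpen_iInter_of_finite fun i => isOpen_lt ?_ continuous_const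
      have h (y : X) : Continuous fun f : Fin n → WeakDual ℝ X => f i y :=
        (WeakDual.eval_continuous y).comp (continuous_apply i)
      exact ((h _).sub (h _)).abs
    have hcov : Q ⊆ ⋃ a, O a := by
      intro f _
      let N : Set (WeakSpace ℝ X) := ⋂ i, {y | |f i ((toWeakSpace ℝ X).symm y) -
        f i ((toWeakSpace ℝ X).symm x)| < 1}
      have hN : IsOpen N := isOpen_iInter_of_finite fun i => isOpen_lt
        ((continuous_apply_toWeakSpace_symm (WeakDual.toStrongDual (f i))).sub
          continuous_const).abs continuous_const
      obtain ⟨a, haN, haA⟩ := _root_.mem_closure_iff.1 hx N hN (by simp [N])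
      exact mem_iUnion.2 ⟨⟨a, haA⟩, by simpa [O, N] using haN⟩
    obtain ⟨t, ht⟩ := hQ.elim_finite_subcover O hO hcov
    refine ⟨Subtype.val '' (t : Set A), by rintro _ ⟨a, -, rfl⟩; exact a.2,
      t.finite_toSet.image _, fun f hf => ?_⟩
    have hfQ : (fun i => StrongDual.toWeakDual (f i)) ∈ Q := by
      intro i _
      simpa using hf i
    obtain ⟨a, hat, ha⟩ := mem_iUnion₂.1 (ht hfQ)
    exact ⟨a, ⟨a, hat, rfl⟩, ha⟩
  choose F hFA hFfin hF using key
  refine ⟨⋃ n, ⋃ m, F n m, iUnion₂_subset hFA,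
    countable_iUnion fun n => countable_iUnion fun m => (hFfin n m).countable, ?_⟩
  rw [mem_closure_iff_nhds]
  intro U hU
  obtain ⟨s, r, hr, hs⟩ := exists_functionals_of_mem_nhds_weak hU
  -- Rescaling by `r⁻¹` turns the tolerance `r` into `1`.
  let g : Fin s.card → StrongDual ℝ X := fun i => r⁻¹ • (s.equivFin.symm i : StrongDual ℝ X)
  obtain ⟨m, hm⟩ := exists_nat_ge (∑ i, ‖g i‖)
  obtain ⟨a, haF, ha⟩ := hF s.card m g fun i =>
    (Finset.single_le_sum (f := fun i => ‖g i‖) (fun _ _ => norm_nonneg _)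
      (Finset.mem_univ i)).trans hm
  refine ⟨a, hs a fun f hf => ?_, mem_iUnion₂.2 ⟨_, _, haF⟩⟩
  have h := ha (s.equivFin ⟨f, hf⟩)
  simp only [g, Equiv.symm_apply_apply, smul_apply, smul_eq_mul] at h
  rwa [← mul_sub, abs_mul, abs_of_pos (inv_pos.2 hr), inv_mul_lt_iff₀ hr, mul_one] at h

/-- If every point of `A` lies in the weak closure of the points of `A` related to it, then the
same holds for some non-empty countable subset of `A`. -/
theorem exists_countable_subset_forall_mem_closure_weak {X : Type*} [NormedAddCommGroup X]
    [NormedSpace ℝ X] {A : Set (WeakSpace ℝ X)} (hA : A.Nonempty)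
    {P : WeakSpace ℝ X → WeakSpace ℝ X → Prop} (h : ∀ x ∈ A, x ∈ closure {y ∈ A | P x y}) :
    ∃ D ⊆ A, D.Nonempty ∧ D.Countable ∧ ∀ x ∈ D, x ∈ closure {y ∈ D | P x y} := by
  have h' : ∀ x : WeakSpace ℝ X, ∃ C : Set (WeakSpace ℝ X), C ⊆ {y ∈ A | P x y} ∧ C.Countable ∧
      (x ∈ A → x ∈ closure C) := by
    intro x
    by_cases hx : x ∈ A
    · obtain ⟨C, hC, hc, hxC⟩ := exists_countable_subset_mem_closure_weak (h x hx)
      exact ⟨C, hC, hc, fun _ => hxC⟩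
    · exact ⟨∅, empty_subset _, countable_empty, fun h => absurd h hx⟩
  choose C hC hCc hCx using h'
  obtain ⟨a, ha⟩ := hA
  -- Closing off: each stage collects countable witnesses for all points of the previous one.
  let D : ℕ → Set (WeakSpace ℝ X) := fun n => Nat.rec {a} (fun _ S => ⋃ x ∈ S, C x) n
  have hD : ∀ n, D n ⊆ A ∧ (D n).Countable := by
    intro n
    induction n with
    | zero => exact ⟨singleton_subset_iff.2 ha, countable_singleton a⟩
    | succ n ih =>
      exact ⟨iUnion₂_subset fun x _ => (hC x).trans (sep_subset _ _), ih.2.biUnion fun x _ => hCc x⟩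
  have haD : a ∈ D 0 := mem_singleton a
  refine ⟨⋃ n, D n, iUnion_subset fun n => (hD n).1, ⟨a, mem_iUnion.2 ⟨0, haD⟩⟩,
    countable_iUnion fun n => (hD n).2, fun x hx => ?_⟩
  obtain ⟨n, hn⟩ := mem_iUnion.1 hx
  have hsub : C x ⊆ {y ∈ ⋃ n, D n | P x y} := by
    intro y hy
    have hyD : y ∈ D (n + 1) := mem_iUnion₂.2 ⟨x, hn, hy⟩
    exact ⟨mem_iUnion.2 ⟨n + 1, hyD⟩, (hC x hy).2⟩
  exact closure_mono hsub (hCx x ((hD n).1 hn))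

/-- The weak closure of a countable set is covered by countably many closed balls of any given
positive radius. -/
theorem exists_countable_cover_closure_weak {X : Type*} [NormedAddCommGroup X] [NormedSpace ℝ X]
    {D : Set (WeakSpace ℝ X)} (hD : D.Countable) {r : ℝ} (hr : 0 < r) :
    ∃ c : Set X, c.Countable ∧ closure D ⊆ ⋃ z ∈ c, toWeakSpace ℝ X '' closedBall z r := by
  let S : Submodule ℝ X := Submodule.span ℝ ((toWeakSpace ℝ X).symm '' D)
  have hS : TopologicalSpace.IsSeparable (S : Set X) :=
    (hD.image _).isSeparable.span
  obtain ⟨c, hc, hSc⟩ := hS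
  refine ⟨c, hc, ?_⟩
  -- The norm closure of the span is convex, hence weakly closed, and it is separable.
  have h1 : closure D ⊆ toWeakSpace ℝ X '' closure (S : Set X) := by
    rw [S.convex.toWeakSpace_closure ℝ]
    refine closure_mono fun x hx => ⟨(toWeakSpace ℝ X).symm x, ?_, by simp⟩
    exact Submodule.subset_span (mem_image_of_mem _ hx)
  refine h1.trans ?_
  rintro _ ⟨x, hx, rfl⟩
  have hx' : x ∈ closure c := closure_minimal hSc isClosed_closure hx
  obtain ⟨z, hz, hxz⟩ := Metric.mem_closure_iff.1 hx' r hr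
  exact mem_iUnion₂.2 ⟨z, hz, x, hxz.le, rfl⟩

/-- **Namioka's theorem**: weakly compact subsets of a normed space are fragmented by the norm. -/
theorem IsCompact.exists_isOpen_weak_norm_sub_le {X : Type*} [NormedAddCommGroup X]
    [NormedSpace ℝ X] {K V : Set (WeakSpace ℝ X)} (hK : IsCompact K) (hV : IsOpen V)
    (hVK : (V ∩ K).Nonempty) {ε : ℝ} (hε : 0 < ε) :
    ∃ U ⊆ V, IsOpen U ∧ (U ∩ K).Nonempty ∧ ∀ x ∈ U ∩ K, ∀ y ∈ U ∩ K,
      ‖(toWeakSpace ℝ X).symm x - (toWeakSpace ℝ X).symm y‖ ≤ ε := by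
  by_contra! hcon
  let e := (toWeakSpace ℝ X).symm
  -- If `‖p - q‖ > ε`, then `p` or `q` is farther than `ε / 2` from `x`.
  have hcl : ∀ x ∈ V ∩ K, x ∈ closure {y ∈ V ∩ K | ε / 2 < ‖e x - e y‖} := by
    intro x hx
    rw [_root_.mem_closure_iff]
    intro U hU hxU
    obtain ⟨p, hp, q, hq, hpq⟩ :=
      hcon (U ∩ V) inter_subset_right (hU.inter hV) ⟨x, ⟨hxU, hx.1⟩, hx.2⟩
    by_cases hxp : ε / 2 < ‖e x - e p‖
    · exact ⟨p, hp.1.1, ⟨hp.1.2, hp.2⟩, hxp⟩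
    · refine ⟨q, hq.1.1, ⟨hq.1.2, hq.2⟩, ?_⟩
      have := norm_sub_le_norm_sub_add_norm_sub (e p) (e x) (e q)
      rw [norm_sub_rev (e p) (e x)] at this
      change ε < ‖e p - e q‖ at hpq
      linarith
  obtain ⟨D, hDA, ⟨d₀, hd₀⟩, hDc, hD⟩ := exists_countable_subset_forall_mem_closure_weak hVK hcl
  have hLc : IsCompact (closure D) := hK.closure_of_subset (hDA.trans inter_subset_right)
  obtain ⟨c, hc, hcov⟩ := exists_countable_cover_closure_weak hDc (show 0 < ε / 4 by positivity)
  have : CompactSpace (closure D) := isCompact_iff_compactSpace.1 hLc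
  have : Nonempty (closure D) := ⟨⟨d₀, subset_closure hd₀⟩⟩
  have := hc.to_subtype
  -- Baire category in the weakly compact set `closure D`: some ball of radius `ε / 4` contains a
  -- nonempty relatively open piece. Points of `D` there are within `ε / 2` of each other,
  -- contradicting `hD`.
  obtain ⟨⟨z, _⟩, w, hw⟩ := nonempty_interior_of_iUnion_of_closed
    (f := fun z : c => ((↑) : closure D → WeakSpace ℝ X) ⁻¹'
      (toWeakSpace ℝ X '' closedBall (z : X) (ε / 4)))
    (fun z => (isClosed_toWeakSpace_image_closedBall _ _).preimage continuous_subtype_val)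
    (by
      rw [eq_univ_iff_forall]
      intro y
      obtain ⟨z, hz, hy⟩ := mem_iUnion₂.1 (hcov y.2)
      exact mem_iUnion.2 ⟨⟨z, hz⟩, hy⟩)
  obtain ⟨O, hOz, hO, hwO⟩ := mem_interior.1 hw
  obtain ⟨U, hU, rfl⟩ := isOpen_induced_iff.1 hO
  have hball : ∀ y ∈ U ∩ D, ‖e y - z‖ ≤ ε / 4 := by
    intro y hy
    obtain ⟨y', hy', hyy⟩ := @hOz ⟨y, subset_closure hy.2⟩ hy.1
    rw [← mem_closedBall_iff_norm]
    have : e y = y' := by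
      change toWeakSpace ℝ X y' = y at hyy
      simp [e, ← hyy]
    rwa [this]
  obtain ⟨d, hdU, hdD⟩ := _root_.mem_closure_iff.1 w.2 U hU hwO
  obtain ⟨y, hyU, hyD, hy⟩ := _root_.mem_closure_iff.1 (hD d hdD) U hU hdU
  have h1 := hball d ⟨hdU, hdD⟩
  have h2 := hball y ⟨hyU, hyD⟩
  have h3 := norm_sub_le_norm_sub_add_norm_sub (e d) z (e y)
  rw [norm_sub_rev z (e y)] at h3
  linarith

/-! ### Adjoints of weakly compact operators -/

/-- Every weak-star continuous linear functional on a dual space is an evaluation. -/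
theorem WeakDual.exists_forall_apply_eq {E : Type*} [NormedAddCommGroup E] [NormedSpace ℝ E]
    (F : StrongDual ℝ (WeakDual ℝ E)) : ∃ g : E, ∀ χ : WeakDual ℝ E, F χ = χ g := by
  have h := LinearMap.dualEmbedding_surjective (𝕜 := ℝ) (topDualPairing ℝ E)
  obtain ⟨g, hg⟩ := h F
  exact ⟨g, fun χ => (DFunLike.congr_fun hg χ).symm⟩

/-- If `T` is weakly compact, then its second adjoint takes values in `X`. -/
theorem IsWeaklyCompactOperator.exists_forall_apply_comp_eq {X Y : Type*} [NormedAddCommGroup X]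
    [NormedSpace ℝ X] [NormedAddCommGroup Y] [NormedSpace ℝ Y] {T : X →L[ℝ] Y}
    (hT : IsWeaklyCompactOperator T) (φ : StrongDual ℝ (StrongDual ℝ X)) :
    ∃ y : Y, ∀ f : StrongDual ℝ Y, φ (f.comp T) = f y := by
  let K : Set (WeakSpace ℝ Y) := closure (toWeakSpace ℝ Y '' (T '' closedBall (0 : X) 1))
  have hconv : Convex ℝ K := by
    refine Convex.closure ?_
    exact ((convex_closedBall (0 : X) 1).linear_image T.toLinearMap).linear_image
      (toWeakSpace ℝ Y).toLinearMap
  -- The factor `‖φ‖` makes `J '' K` large enough to contain `ψ = T**φ`; otherwise a separating `g`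
  -- would give `‖φ‖ * ‖g ∘ T‖ ≤ u < φ (g ∘ T)`.
  let J : WeakSpace ℝ Y →L[ℝ] WeakDual ℝ (StrongDual ℝ Y) :=
    ‖φ‖ • NormedSpace.inclusionInDoubleDualWeak ℝ Y
  have hJ (y : WeakSpace ℝ Y) (f : StrongDual ℝ Y) :
      J y f = ‖φ‖ * f ((toWeakSpace ℝ Y).symm y) := by
    simp only [J, smul_apply]
    rfl
  let ψ : WeakDual ℝ (StrongDual ℝ Y) := StrongDual.toWeakDual
    (φ.comp ((ContinuousLinearMap.compL ℝ X Y ℝ).flip T))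
  have hψ (f : StrongDual ℝ Y) : ψ f = φ (f.comp T) := rfl
  by_cases hmem : ψ ∈ J '' K
  · obtain ⟨y, -, hy⟩ := hmem
    refine ⟨‖φ‖ • (toWeakSpace ℝ Y).symm y, fun f => ?_⟩
    rw [← hψ, ← hy, hJ, map_smul, smul_eq_mul]
  · exfalso
    have hJK : IsCompact (J '' K) := IsCompact.image hT J.continuous
    have : LocallyConvexSpace ℝ (WeakDual ℝ (StrongDual ℝ Y)) :=
      WithSeminorms.toLocallyConvexSpace (WeakDual.withSeminorms ℝ (StrongDual ℝ Y))
    obtain ⟨F, u, hF, hu⟩ := geometric_hahn_banach_closed_point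
      (hconv.linear_image J.toLinearMap) hJK.isClosed hmem
    obtain ⟨g, hFg⟩ := WeakDual.exists_forall_apply_eq F
    have hle : ∀ x : X, ‖x‖ ≤ 1 → ‖φ‖ * g (T x) < u := by
      intro x hx
      have hxK : toWeakSpace ℝ Y (T x) ∈ K := subset_closure (mem_image_of_mem _
        (mem_image_of_mem T (mem_closedBall_zero_iff.2 hx)))
      have h := hF (J (toWeakSpace ℝ Y (T x))) (mem_image_of_mem J hxK)
      rwa [hFg, hJ, LinearEquiv.symm_apply_apply] at h
    have hu0 : 0 ≤ u := by simpa using (hle 0 (by simp)).le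
    have hnorm : ‖‖φ‖ • g.comp T‖ ≤ u := by
      refine ContinuousLinearMap.opNorm_le_of_unit_norm hu0 fun x hx => ?_
      rw [Real.norm_eq_abs, abs_le]
      have h1 := hle x hx.le
      have h2 := hle (-x) (by simp [hx])
      simp only [map_neg, mul_neg] at h2
      simp only [smul_apply, ContinuousLinearMap.comp_apply, smul_eq_mul]
      constructor <;> linarith
    rw [norm_smul, Real.norm_of_nonneg (norm_nonneg φ)] at hnorm
    have h3 : φ (g.comp T) ≤ ‖φ‖ * ‖g.comp T‖ := (le_abs_self _).trans (φ.le_opNorm _)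
    rw [hFg, hψ] at hu
    linarith

/-- The adjoint of a weakly compact operator is continuous from the weak-star topology to the weak
topology. -/
theorem IsWeaklyCompactOperator.continuous_adjoint {X Y : Type*} [NormedAddCommGroup X]
    [NormedSpace ℝ X] [NormedAddCommGroup Y] [NormedSpace ℝ Y] {T : X →L[ℝ] Y}
    (hT : IsWeaklyCompactOperator T) :
    Continuous fun f : WeakDual ℝ Y =>
      toWeakSpace ℝ (StrongDual ℝ X) ((WeakDual.toStrongDual f).comp T) := by
  -- Tested against `φ`, the adjoint becomes evaluation at a point of `Y`.
  refine WeakBilin.continuous_of_continuous_eval _ fun φ => ?_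
  obtain ⟨y, hy⟩ := hT.exists_forall_apply_comp_eq φ
  exact (WeakDual.eval_continuous y).congr fun f => (hy (WeakDual.toStrongDual f)).symm

/-! ### The two thickness estimates -/

/-- One `ε` pays for replacing `y` by `y₀`, the other for normalising `y₀`, which moves it by `1 -
‖y₀‖ < ε`. -/
theorem norm_add_inv_norm_smul_le {E : Type*} [NormedAddCommGroup E] [NormedSpace ℝ E]
    {x y y₀ : E} {c ε : ℝ} (hxy : ‖x + y‖ ≤ c) (hy : ‖y - y₀‖ ≤ ε) (h0 : y₀ ≠ 0)
    (h1 : ‖y₀‖ ≤ 1) (h2 : 1 - ε < ‖y₀‖) : ‖x + ‖y₀‖⁻¹ • y₀‖ ≤ c + 2 * ε := by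
  have hpos : 0 < ‖y₀‖ := norm_pos_iff.2 h0
  have h3 : ‖‖y₀‖⁻¹ • y₀ - y₀‖ ≤ ε := by
    have : ‖y₀‖⁻¹ • y₀ - y₀ = (‖y₀‖⁻¹ - 1) • y₀ := by rw [sub_smul, one_smul]
    rw [this, norm_smul, Real.norm_eq_abs, abs_of_nonneg (by
      rw [sub_nonneg]; exact (one_le_inv₀ hpos).2 h1), sub_mul, inv_mul_cancel₀ hpos.ne']
    linarith
  have h4 : x + ‖y₀‖⁻¹ • y₀ = (x + y) - (y - y₀) + (‖y₀‖⁻¹ • y₀ - y₀) := by abel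
  rw [h4]
  linarith [norm_add_le ((x + y) - (y - y₀)) (‖y₀‖⁻¹ • y₀ - y₀), norm_sub_le (x + y) (y - y₀)]

theorem daugavetThickness_le_norm_add_id {X : Type*} [NormedAddCommGroup X] [NormedSpace ℝ X]
    {T : X →L[ℝ] X} (hT : IsWeaklyCompactOperator T) (hT1 : ‖T‖ = 1) :
    daugavetThickness X ≤ ‖T + ContinuousLinearMap.id ℝ X‖ := by
  refine le_of_forall_pos_le_add fun δ hδ => ?_
  obtain ⟨ε, hε, hε1, hεδ⟩ : ∃ ε : ℝ, 0 < ε ∧ ε < 1 ∧ 2 * ε ≤ δ :=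
    ⟨min (1 / 2) (δ / 2), by positivity, by linarith [min_le_left (1 / 2) (δ / 2)],
      by linarith [min_le_right (1 / 2) (δ / 2)]⟩
  refine csInf_le ⟨0, fun r hr => hr.1.le⟩ ⟨by positivity, ?_⟩
  have hball (x : X) (hx : ‖x‖ ≤ 1) : ‖T x‖ ≤ 1 := by
    simpa [hT1] using T.le_of_opNorm_le_of_le hT1.le hx
  let K : Set (WeakSpace ℝ X) := closure (toWeakSpace ℝ X '' (T '' closedBall (0 : X) 1))
  have hTK (x : X) (hx : ‖x‖ ≤ 1) : toWeakSpace ℝ X (T x) ∈ K :=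
    subset_closure ⟨T x, ⟨x, by simpa using hx, rfl⟩, rfl⟩
  obtain ⟨x₁, hx₁', hTx₁⟩ := T.exists_lt_apply_of_lt_opNorm (r := 1 - ε) (by linarith)
  have hx₁ := hx₁'.le
  obtain ⟨U, hUV, hU, ⟨p, hpU, hpK⟩, hUK⟩ := IsCompact.exists_isOpen_weak_norm_sub_le (K := K) hT
    (isOpen_weak_setOf_lt_norm (1 - ε)) ⟨_, by simpa using hTx₁, hTK x₁ hx₁⟩ hε
  -- The point `p` is only in the closure; a genuine value `T x₀` in `U` makes the preimage of `U`
  -- meet the ball.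
  obtain ⟨_, hyU, _, ⟨x₀, hx₀, rfl⟩, rfl⟩ := _root_.mem_closure_iff.1 hpK U hU hpU
  rw [mem_closedBall_zero_iff] at hx₀
  have hy₀ : 1 - ε < ‖T x₀‖ := by simpa using hUV hyU
  have hne : T x₀ ≠ 0 := norm_pos_iff.1 (by linarith)
  refine ⟨1, fun _ => -(‖T x₀‖⁻¹ • T x₀), fun _ => ?_, WeakSpace.map T ⁻¹' U,
    hU.preimage (WeakSpace.map T).continuous, ⟨x₀, hyU, by simpa using hx₀⟩, ?_⟩
  · rw [norm_neg, norm_smul, norm_inv, norm_norm, inv_mul_cancel₀ (norm_ne_zero_iff.2 hne)]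
  · rintro x ⟨hxU, hx⟩
    rw [mem_closedBall_zero_iff] at hx
    refine mem_iUnion.2 ⟨0, ?_⟩
    rw [mem_closedBall_iff_norm, sub_neg_eq_add]
    have hxy : ‖x + T x‖ ≤ ‖T + ContinuousLinearMap.id ℝ X‖ := by
      have := (T + ContinuousLinearMap.id ℝ X).unit_le_opNorm x hx
      rwa [add_apply, ContinuousLinearMap.id_apply, add_comm] at this
    have hTx : ‖T x - T x₀‖ ≤ ε := by
      simpa using hUK (toWeakSpace ℝ X (T x)) ⟨hxU, hTK x hx⟩ (toWeakSpace ℝ X (T x₀))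
        ⟨hyU, hTK x₀ hx₀⟩
    exact (norm_add_inv_norm_smul_le hxy hTx hne (hball x₀ hx₀) hy₀).trans (by linarith)

theorem weakStarDaugavetThicknessDual_le_norm_add_id {X : Type*} [NormedAddCommGroup X]
    [NormedSpace ℝ X] {T : X →L[ℝ] X} (hT : IsWeaklyCompactOperator T) (hT1 : ‖T‖ = 1) :
    weakStarDaugavetThicknessDual X ≤ ‖T + ContinuousLinearMap.id ℝ X‖ := by
  refine le_of_forall_pos_le_add fun δ hδ => ?_
  obtain ⟨ε, hε, hε1, hεδ⟩ : ∃ ε : ℝ, 0 < ε ∧ ε < 1 ∧ 2 * ε ≤ δ :=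
    ⟨min (1 / 2) (δ / 2), by positivity, by linarith [min_le_left (1 / 2) (δ / 2)],
      by linarith [min_le_right (1 / 2) (δ / 2)]⟩
  refine csInf_le ⟨0, fun r hr => hr.1.le⟩ ⟨by positivity, ?_⟩
  have hball (f : StrongDual ℝ X) (hf : ‖f‖ ≤ 1) : ‖f.comp T‖ ≤ 1 :=
    (f.opNorm_comp_le T).trans (by rwa [hT1, mul_one])
  let G : WeakDual ℝ X → WeakSpace ℝ (StrongDual ℝ X) := fun f =>
    toWeakSpace ℝ (StrongDual ℝ X) ((WeakDual.toStrongDual f).comp T)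
  have hG : Continuous G := hT.continuous_adjoint
  let K : Set (WeakSpace ℝ (StrongDual ℝ X)) :=
    G '' (WeakDual.toStrongDual ⁻¹' closedBall (0 : StrongDual ℝ X) 1)
  have hK : IsCompact K := (WeakDual.isCompact_closedBall 0 1).image hG
  have hGK (f : StrongDual ℝ X) (hf : ‖f‖ ≤ 1) : G (StrongDual.toWeakDual f) ∈ K :=
    ⟨_, by simpa using hf, rfl⟩
  obtain ⟨x₁, hx₁', hTx₁⟩ := T.exists_lt_apply_of_lt_opNorm (r := 1 - ε) (by linarith)
  have hx₁ := hx₁'.le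
  -- A norming functional of `T x₁` shows that the adjoint also nearly attains norm `1`.
  obtain ⟨f₁, hf₁, hfT⟩ := exists_dual_vector'' ℝ (T x₁)
  have hf₁T : 1 - ε < ‖f₁.comp T‖ := by
    refine hTx₁.trans_le ?_
    have := (f₁.comp T).unit_le_opNorm x₁ hx₁
    rw [ContinuousLinearMap.comp_apply, hfT] at this
    simpa using this
  obtain ⟨U, hUV, hU, ⟨_, hyU, f₀, hf₀, rfl⟩, hUK⟩ := hK.exists_isOpen_weak_norm_sub_le
    (isOpen_weak_setOf_lt_norm (1 - ε)) ⟨_, by simpa [G] using hf₁T, hGK f₁ hf₁⟩ hε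
  obtain ⟨f₀, rfl⟩ := StrongDual.toWeakDual.surjective f₀
  replace hf₀ : ‖f₀‖ ≤ 1 := by simpa using hf₀
  have hy₀ : 1 - ε < ‖f₀.comp T‖ := by simpa [G] using hUV hyU
  have hne : f₀.comp T ≠ 0 := norm_pos_iff.1 (by linarith)
  refine ⟨1, fun _ => -(‖f₀.comp T‖⁻¹ • f₀.comp T), fun _ => ?_, G ⁻¹' U,
    hU.preimage hG, ⟨f₀, hyU, by simpa using hf₀⟩, ?_⟩
  · rw [norm_neg, norm_smul, norm_inv, norm_norm, inv_mul_cancel₀ (norm_ne_zero_iff.2 hne)]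
  · rintro f ⟨hfU, hf⟩
    rw [mem_closedBall_zero_iff] at hf
    refine mem_iUnion.2 ⟨0, ?_⟩
    rw [mem_closedBall_iff_norm, sub_neg_eq_add]
    have hfy : ‖f + f.comp T‖ ≤ ‖T + ContinuousLinearMap.id ℝ X‖ := by
      have h : f + f.comp T = f.comp (T + ContinuousLinearMap.id ℝ X) := by
        rw [ContinuousLinearMap.comp_add, ContinuousLinearMap.comp_id, add_comm]
      rw [h]
      exact (f.opNorm_comp_le _).trans (mul_le_of_le_one_left (norm_nonneg _) hf)
    have hfT : ‖f.comp T - f₀.comp T‖ ≤ ε := by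
      simpa [G] using hUK (G (StrongDual.toWeakDual f)) ⟨hfU, hGK f hf⟩
        (G (StrongDual.toWeakDual f₀)) ⟨hyU, hGK f₀ hf₀⟩
    exact (norm_add_inv_norm_smul_le hfy hfT hne (hball f₀ hf₀) hy₀).trans (by linarith)

theorem proposition4p3 (X : Type*) [NormedAddCommGroup X] [NormedSpace ℝ X] [CompleteSpace X]
    (T : X →L[ℝ] X) (hT : IsWeaklyCompactOperator T) (hT1 : ‖T‖ = 1) :
    daugavetThickness X ≤ ‖T + ContinuousLinearMap.id ℝ X‖ ∧
      weakStarDaugavetThicknessDual X ≤ ‖T + ContinuousLinearMap.id ℝ X‖ :=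
  ⟨daugavetThickness_le_norm_add_id hT hT1, weakStarDaugavetThicknessDual_le_norm_add_id hT hT1⟩
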